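/- An alternating sign matrix (ASM) of size $n$ is an $n\times n$ matrix with entries in $\{-1,0,1\}$ such that every row sum and every column sum equals $1$ and the non-zero entries alternate in sign along each row and each column. For an ASM $A$ let $\mu(A)$ denote the number of entries of $A$ equal to $-1$, and for $Q$ let $$A_n(Q)=\sum_{A\ \text{ASM of size } n} Q^{\mu(A)}$$ be the $Q$-enumeration of ASMs of size $n$. Then for every $n\ge 0$ the $2$-enumeration of ASMs of size $n$ is given by $$A_n(2)=2^{\binom{n}{2}}.$$ -/

import Mathlib

/-- The non-zero terms of a finite sequence alternate in sign: whenever two non-zero terms are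
consecutive among the non-zero terms, each is the negative of the other (for entries in
`{-1, 0, 1}`, this means that they have opposite signs). -/
def NonzeroAlternate {n : ℕ} (v : Fin n → ℤ) : Prop :=
  ∀ i j : Fin n, i < j → v i ≠ 0 → v j ≠ 0 → (∀ k, i < k → k < j → v k = 0) → v j = -v i

/-- Alternating sign matrices of size `n`. -/
structure IsASM {n : ℕ} (A : Matrix (Fin n) (Fin n) ℤ) : Prop where
  entries : ∀ i j, A i j = -1 ∨ A i j = 0 ∨ A i j = 1
  row_sum : ∀ i, ∑ j, A i j = 1
  col_sum : ∀ j, ∑ i, A i j = 1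
  row_alternate : ∀ i, NonzeroAlternate (fun j => A i j)
  col_alternate : ∀ j, NonzeroAlternate (fun i => A i j)

theorem finite_isASM (n : ℕ) : {A : Matrix (Fin n) (Fin n) ℤ | IsASM A}.Finite := by
  have h : (Set.univ.pi fun _ : Fin n => Set.univ.pi fun _ : Fin n =>
      ({-1, 0, 1} : Set ℤ)).Finite :=
    Set.Finite.pi fun _ => Set.Finite.pi fun _ => Set.toFinite _
  exact h.subset fun A hA i _ j _ => hA.entries i j

/-- The finite set of all alternating sign matrices of size `n`. -/
noncomputable def asmFinset (n : ℕ) : Finset (Matrix (Fin n) (Fin n) ℤ) :=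
  (finite_isASM n).toFinset

/-- The number of entries of a matrix that are equal to `-1`. -/
def numNegOnes {n : ℕ} (A : Matrix (Fin n) (Fin n) ℤ) : ℕ :=
  (Finset.univ.filter fun p : Fin n × Fin n => A p.1 p.2 = -1).card

/-- The `Q`-enumeration of alternating sign matrices of size `n`: each of them is counted with
the weight `Q` to the power of the number of its entries `-1`. -/
noncomputable def asmEnumeration {R : Type*} [CommSemiring R] (n : ℕ) (Q : R) : R :=
  ∑ A ∈ asmFinset n, Q ^ numNegOnes A

/-!
The sum of the first `m` rows of an alternating sign matrix is the indicator function `1_S` of a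
set `S` of `m` columns. If the first `m - 1` rows have sum `1_T`, then row `m` is `1_S - 1_T`, and
it is admissible exactly if its partial sums are `0` or `1`. For the increasing enumerations `k` of
`S` and `l` of `T`, this means `k i ≤ l i ≤ k (i + 1)`, so alternating sign matrices are chains of
interlacing sets (`mem_partialASM`, `interlaces_image_iff`). The entries `-1` of row `m` are in the
columns of `T \ S`, that is, those `l i` strictly between `k i` and `k (i + 1)`.

By induction on `m`, the partial matrices ending in `S` have total weight
`2 ^ C(m, 2) * det (C(k i, j))` (`sum_partialASM_image`). In the induction step, the sum over
strictly increasing `l` may be extended to the whole box `∏ [k i, k (i + 1)]`, since the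
determinant vanishes if two entries of `l` agree. The weight is now a product, with a factor `1` at
the ends of each interval and `2` inside, so by multilinearity the sum is a determinant of trapezoid
sums of binomial coefficients. These are differences of `2 C(x, j + 1) + C(x, j)`
(`sum_Icc_trapezoid_choose`), and row and column operations reduce their determinant to
`2 ^ m * det (C(k i, j))` (`det_trapezoid`). For the set of all columns, `det (C(i, j)) = 1`.
-/

/-! ### Alternating sequences and partial sums -/

/-- The sum of the entries of `v` with index less than `k`. -/
def partialSum {n : ℕ} (v : Fin n → ℤ) (k : ℕ) : ℤ :=
  ∑ j ∈ Finset.univ.filter (fun j : Fin n => (j : ℕ) < k), v j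

theorem partialSum_zero {n : ℕ} (v : Fin n → ℤ) : partialSum v 0 = 0 := by
  simp [partialSum]

theorem partialSum_of_le {n : ℕ} (v : Fin n → ℤ) {k : ℕ} (hk : n ≤ k) :
    partialSum v k = ∑ j, v j := by
  unfold partialSum
  rw [Finset.filter_true_of_mem]
  intro j _
  omega

theorem partialSum_succ {n : ℕ} (v : Fin n → ℤ) (j : Fin n) :
    partialSum v (j + 1) = partialSum v j + v j := by
  unfold partialSum
  have : (Finset.univ.filter fun i : Fin n => (i : ℕ) < j + 1) =
      insert j (Finset.univ.filter fun i : Fin n => (i : ℕ) < j) := by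
    ext i
    simp only [Finset.mem_filter, Finset.mem_univ, true_and, Finset.mem_insert, Fin.ext_iff]
    omega
  rw [this, Finset.sum_insert (by simp), add_comm]

theorem partialSum_init {m : ℕ} (v : Fin (m + 1) → ℤ) {k : ℕ} (hk : k ≤ m) :
    partialSum v k = partialSum (fun i : Fin m => v i.castSucc) k := by
  unfold partialSum
  rw [Finset.sum_filter, Finset.sum_filter, Fin.sum_univ_castSucc]
  simp [hk]

/-- The sequences that occur as rows and columns of alternating sign matrices, described by
their partial sums. -/
def IsAlternatingSign {n : ℕ} (v : Fin n → ℤ) : Prop :=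
  (∀ k, partialSum v k = 0 ∨ partialSum v k = 1) ∧ ∑ j, v j = 1

/-- Among the entries with indices in `[a, a + d)`, the sum of an alternating sequence is zero or
the last non-zero entry. -/
theorem NonzeroAlternate.block {n : ℕ} {v : Fin n → ℤ} (h : NonzeroAlternate v) (a d : ℕ)
    (hd : a + d ≤ n) :
    ((∀ j : Fin n, a ≤ j → (j : ℕ) < a + d → v j = 0) ∧
        partialSum v (a + d) = partialSum v a) ∨
      ∃ p : Fin n, a ≤ p ∧ (p : ℕ) < a + d ∧ v p ≠ 0 ∧
        (∀ j, p < j → (j : ℕ) < a + d → v j = 0) ∧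
        (partialSum v (a + d) = partialSum v a ∨
          partialSum v (a + d) = partialSum v a + v p) := by
  induction d with
  | zero => exact Or.inl ⟨fun j h1 h2 => by omega, rfl⟩
  | succ d ih =>
    have hlt : a + d < n := by omega
    let q : Fin n := ⟨a + d, hlt⟩
    have hs : partialSum v (a + (d + 1)) = partialSum v (a + d) + v q := partialSum_succ v q
    have hq : ∀ j : Fin n, (j : ℕ) < a + (d + 1) → (j : ℕ) < a + d ∨ j = q := by
      intro j hj
      rw [Fin.ext_iff]
      change _ ∨ (j : ℕ) = a + d
      omega
    rw [hs]
    by_cases hvq : v q = 0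
    · rcases ih (by omega) with ⟨h1, h2⟩ | ⟨p, h1, h2, h3, h4, h5⟩
      · refine Or.inl ⟨fun j hj hj' => ?_, by rw [h2, hvq, add_zero]⟩
        rcases hq j hj' with h | rfl
        · exact h1 j hj h
        · exact hvq
      · refine Or.inr ⟨p, h1, by omega, h3, fun j hj hj' => ?_, by rwa [hvq, add_zero]⟩
        rcases hq j hj' with h | rfl
        · exact h4 j hj h
        · exact hvq
    · refine Or.inr ⟨q, Nat.le_add_right a d, Nat.lt_succ_self _, hvq, fun j hj hj' => ?_, ?_⟩
      · have : a + d < (j : ℕ) := hj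
        omega
      · rcases ih (by omega) with ⟨h1, h2⟩ | ⟨p, h1, h2, h3, h4, h5⟩
        · exact Or.inr (by rw [h2])
        · have := h p q h2 h3 hvq fun k hk hk' => h4 k hk hk'
          rcases h5 with h5 | h5
          · exact Or.inr (by rw [h5])
          · exact Or.inl (by rw [h5, this]; ring)

/-- Rows and columns of alternating sign matrices are the sequences with total sum `1` all of whose
partial sums are `0` or `1`. -/
theorem isAlternatingSign_iff {n : ℕ} (v : Fin n → ℤ) :
    IsAlternatingSign v ↔
      (∀ j, v j = -1 ∨ v j = 0 ∨ v j = 1) ∧ ∑ j, v j = 1 ∧ NonzeroAlternate v := by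
  constructor
  · rintro ⟨h, h1⟩
    refine ⟨fun j => ?_, h1, fun i j hij hi hj hz => ?_⟩
    · have := partialSum_succ v j
      have a1 := h j
      have a2 := h (j + 1)
      omega
    · have hc : ∀ d : ℕ, (i : ℕ) + 1 + d ≤ j →
          partialSum v (i + 1 + d) = partialSum v (i + 1) := by
        intro d
        induction d with
        | zero => intro _; rfl
        | succ d ih =>
          intro hd
          have hlt : (i : ℕ) + 1 + d < n := by omega
          have := partialSum_succ v ⟨i + 1 + d, hlt⟩
          rw [hz ⟨i + 1 + d, hlt⟩ (by rw [Fin.lt_def]; simp only; omega)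
            (by rw [Fin.lt_def]; simp only; omega), add_zero] at this
          rw [← ih (by omega)]
          exact this
      have hij' : (i : ℕ) < j := hij
      have e := hc (j - (i + 1)) (by omega)
      rw [Nat.add_sub_cancel' hij'] at e
      have e1 := partialSum_succ v i
      have e2 := partialSum_succ v j
      have a1 := h i
      have a2 := h j
      have a3 := h (j + 1)
      omega
  · rintro ⟨he, h1, h⟩
    refine ⟨fun k => ?_, h1⟩
    have hn : partialSum v n = 1 := by rw [partialSum_of_le v le_rfl, h1]
    -- A partial sum is both a block starting at the first entry and the complement of a block
    -- ending at the last one; each block has sum at most one in absolute value.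
    have key : ∀ a d, a + d ≤ n → partialSum v (a + d) - partialSum v a ≤ 1 ∧
        -1 ≤ partialSum v (a + d) - partialSum v a := by
      intro a d hd
      rcases h.block a d hd with ⟨-, h2⟩ | ⟨p, -, -, -, -, h2⟩
      · omega
      · have := he p
        omega
    rcases le_total n k with hk | hk
    · right
      rw [partialSum_of_le v hk, h1]
    · have a1 := key 0 k (by omega)
      have a2 := key k (n - k) (by omega)
      rw [partialSum_zero, zero_add] at a1
      rw [Nat.add_sub_cancel' hk] at a2
      omega

/-! ### Determinants of binomial coefficients -/

theorem sum_Ico_choose (a b j : ℕ) (hab : a ≤ b) :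
    ∑ x ∈ Finset.Ico a b, (x.choose j : ℤ) = b.choose (j + 1) - a.choose (j + 1) := by
  induction b, hab using Nat.le_induction with
  | base => simp
  | succ b hab ih =>
    rw [Finset.sum_Ico_succ_top hab, ih, Nat.choose_succ_succ]
    push_cast
    ring

/-- Summing `C(x, j)` by the trapezoid rule, with weight `1` at both ends and `2` in between,
amounts to taking differences of `2 C(x, j + 1) + C(x, j)`. -/
theorem sum_Icc_trapezoid_choose (a b j : ℕ) (hab : a < b) :
    ∑ x ∈ Finset.Icc a b, (if x = a ∨ x = b then 1 else 2 : ℤ) * (x.choose j : ℤ) =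
      (2 * (b.choose (j + 1) : ℤ) + b.choose j) - (2 * (a.choose (j + 1) : ℤ) + a.choose j) := by
  have h1 : ∑ x ∈ Finset.Ioo a b, (if x = a ∨ x = b then 1 else 2 : ℤ) * (x.choose j : ℤ) =
      2 * ∑ x ∈ Finset.Ioo a b, (x.choose j : ℤ) := by
    rw [Finset.mul_sum]
    refine Finset.sum_congr rfl fun x hx => ?_
    rw [Finset.mem_Ioo] at hx
    rw [if_neg (by omega)]
  have h2 := sum_Ico_choose a b j hab.le
  rw [← Finset.Ioo_insert_left hab, Finset.sum_insert (by simp)] at h2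
  rw [← Finset.Ico_insert_right hab.le, Finset.sum_insert (by simp),
    ← Finset.Ioo_insert_left hab, Finset.sum_insert (by simp), h1]
  simp only [true_or, or_true, if_true]
  linarith

/-- The determinant `det (C(k i, j))` of binomial coefficients, which is the Vandermonde product
`∏ (k j - k i)` divided by `∏ (j - i)`, both over all `i < j`. -/
def chooseDet {m : ℕ} (k : Fin m → ℕ) : ℤ :=
  (Matrix.of fun i j : Fin m => ((k i).choose j : ℤ)).det

theorem chooseDet_val (m : ℕ) : chooseDet (fun i : Fin m => (i : ℕ)) = 1 := by
  unfold chooseDet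
  rw [Matrix.det_of_isLowerTriangular]
  · simp
  · intro i j hij
    have : (i : ℕ) < j := hij
    simp [Nat.choose_eq_zero_of_lt this]

theorem chooseDet_eq_zero {m : ℕ} {k : Fin m → ℕ} (hk : ¬ Function.Injective k) :
    chooseDet k = 0 := by
  simp only [Function.Injective, not_forall] at hk
  obtain ⟨i, j, h, hij⟩ := hk
  exact Matrix.det_zero_of_row_eq hij (by ext l; simp [h])

/-- Differences of consecutive values of the trapezoid antiderivatives
`2 C(x, j + 1) + C(x, j)`: bordering by a column of ones gives the determinant of the values
themselves, which arise from binomial coefficients by a triangular change of basis. -/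
theorem det_trapezoid {m : ℕ} (k : Fin (m + 1) → ℕ) :
    (Matrix.of fun i j : Fin m =>
      (2 * ((k i.succ).choose (j + 1) : ℤ) + (k i.succ).choose j) -
        (2 * ((k i.castSucc).choose (j + 1) : ℤ) + (k i.castSucc).choose j)).det =
      2 ^ m * chooseDet k := by
  let U : Matrix (Fin (m + 1)) (Fin (m + 1)) ℤ := Matrix.of fun l =>
    Fin.cases (if l = 0 then 1 else 0)
      (fun j => 2 * (if l = j.succ then 1 else 0) + if l = j.castSucc then 1 else 0)
  let C : Matrix (Fin (m + 1)) (Fin (m + 1)) ℤ := Matrix.of fun i j => ((k i).choose j : ℤ)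
  have hU : U.det = 2 ^ m := by
    rw [Matrix.det_of_isUpperTriangular]
    · rw [Fin.prod_univ_succ]
      have h : ∀ i : Fin m, i.succ ≠ i.castSucc := fun i => i.castSucc_lt_succ.ne'
      simp [U, h]
    · intro i j hij
      have hij : (j : ℕ) < i := hij
      induction j using Fin.cases with
      | zero =>
        have : i ≠ 0 := by rintro rfl; simp at hij
        simp [U, this]
      | succ j =>
        have h1 : i ≠ j.succ := by rintro rfl; omega
        have h2 : i ≠ j.castSucc := by rintro rfl; simp at hij
        simp [U, h1, h2]
  have hC0 : ∀ i, (C * U) i 0 = 1 := by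
    intro i
    simp [Matrix.mul_apply, U, C]
  have hC : ∀ i (j : Fin m),
      (C * U) i j.succ = 2 * ((k i).choose (j + 1) : ℤ) + (k i).choose j := by
    intro i j
    simp [Matrix.mul_apply, U, C, mul_add, Finset.sum_add_distrib, mul_comm]
  let A : Matrix (Fin (m + 1)) (Fin (m + 1)) ℤ := Matrix.of
    (Fin.cases ((C * U) 0) fun i j => (C * U) i.succ j - (C * U) i.castSucc j)
  have hA : (C * U).det = A.det :=
    Matrix.det_eq_of_forall_row_eq_smul_add_pred (fun _ => 1) (fun j => rfl)
      fun i j => by simp [A]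
  rw [chooseDet, mul_comm, ← hU, ← Matrix.det_mul, hA, Matrix.det_succ_column_zero,
    Fin.sum_univ_succ, Finset.sum_eq_zero]
  · simp only [A, Matrix.of_apply, Fin.cases_zero, hC0]
    simp only [Fin.val_zero, pow_zero, one_mul, add_zero, Fin.succAbove_zero]
    congr 1
    ext i j
    simp [hC]
  · intro i _
    simp [A, hC0]

/-- The determinant `chooseDet l` is multilinear in its rows and the weight is a product over the
entries of `l`, so the sum over the box can be taken inside the determinant, row by row. -/
theorem sum_piFinset_chooseDet {m N : ℕ} {k : Fin (m + 1) → Fin N} (hk : StrictMono k) :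
    ∑ l ∈ Fintype.piFinset (fun i : Fin m => Finset.Icc (k i.castSucc) (k i.succ)),
      (∏ i, if l i = k i.castSucc ∨ l i = k i.succ then 1 else 2) *
        chooseDet (fun i => (l i : ℕ)) =
      2 ^ m * chooseDet (fun i => (k i : ℕ)) := by
  rw [← det_trapezoid]
  let g : (i : Fin m) → Fin N → Fin m → ℤ := fun i x =>
    (if x = k i.castSucc ∨ x = k i.succ then 1 else 2 : ℤ) • fun j : Fin m =>
      ((x : ℕ).choose j : ℤ)
  have h := MultilinearMap.map_sum_finset
    (Matrix.detRowAlternating (n := Fin m) (R := ℤ)).toMultilinearMap g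
    (fun i : Fin m => Finset.Icc (k i.castSucc) (k i.succ))
  calc _ = _ := ?_
    _ = _ := h.symm
    _ = _ := ?_
  · refine Finset.sum_congr rfl fun l _ => ?_
    exact (MultilinearMap.map_smul_univ
      (Matrix.detRowAlternating (n := Fin m) (R := ℤ)).toMultilinearMap _ _).symm
  · change Matrix.det _ = _
    congr 1
    ext i j
    have hlt : (k i.castSucc : ℕ) < k i.succ := hk i.castSucc_lt_succ
    rw [Finset.sum_apply, Matrix.of_apply, ← sum_Icc_trapezoid_choose _ _ _ hlt,
      ← Fin.map_valEmbedding_Icc, Finset.sum_map]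
    refine Finset.sum_congr rfl fun x _ => ?_
    simp only [g, Pi.smul_apply, smul_eq_mul, Fin.ext_iff, Fin.valEmbedding_apply]

/-! ### Interlacing sets -/

/-- The indicator function of a set of columns. -/
def columnIndicator {N : ℕ} (S : Finset (Fin N)) (j : Fin N) : ℤ := if j ∈ S then 1 else 0

/-- `T` interlaces `S`: the row `1_S - 1_T` is an admissible row of an alternating sign matrix. -/
def Interlaces {N : ℕ} (T S : Finset (Fin N)) : Prop :=
  IsAlternatingSign fun j => columnIndicator S j - columnIndicator T j

theorem sum_columnIndicator {N : ℕ} (S : Finset (Fin N)) :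
    ∑ j, columnIndicator S j = (S.card : ℤ) := by
  simp [columnIndicator]

theorem Interlaces.card_eq {N : ℕ} {T S : Finset (Fin N)} (h : Interlaces T S) :
    S.card = T.card + 1 := by
  have := h.2
  rw [Finset.sum_sub_distrib, sum_columnIndicator, sum_columnIndicator] at this
  omega

theorem partialSum_columnIndicator_image {m N : ℕ} {k : Fin m → Fin N}
    (hk : Function.Injective k) (x : ℕ) :
    partialSum (columnIndicator (Finset.univ.image k)) x =
      ∑ i, if (k i : ℕ) < x then 1 else 0 := by
  rw [partialSum, Finset.sum_filter]
  have : ∀ j : Fin N, (if (j : ℕ) < x then columnIndicator (Finset.univ.image k) j else 0) =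
      if j ∈ Finset.univ.image k then (if (j : ℕ) < x then 1 else 0) else 0 := by
    intro j
    unfold columnIndicator
    split_ifs <;> rfl
  rw [Finset.sum_congr rfl fun j _ => this j, Finset.sum_ite_mem, Finset.univ_inter,
    Finset.sum_image hk.injOn]

theorem partialSum_sub {n : ℕ} (v w : Fin n → ℤ) (x : ℕ) :
    partialSum (fun j => v j - w j) x = partialSum v x - partialSum w x :=
  Finset.sum_sub_distrib _ _

/-- In an increasing sequence, exactly `i` terms are less than the term of index `i`. -/
theorem sum_lt_apply {m N : ℕ} {k : Fin m → Fin N} (hk : StrictMono k) (i : Fin m) :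
    ∑ i', (if (k i' : ℕ) < k i then 1 else 0 : ℤ) = i := by
  simp only [← Fin.lt_def, hk.lt_iff_lt]
  rw [Finset.sum_boole, Finset.filter_gt_eq_Iio, Fin.card_Iio]

theorem le_sum_of_lt {m N : ℕ} {k : Fin m → Fin N} (hk : StrictMono k) (i : Fin m) {x : ℕ}
    (hx : k i < x) : (i : ℤ) + 1 ≤ ∑ i', (if (k i' : ℕ) < x then 1 else 0 : ℤ) := by
  rw [Finset.sum_boole]
  have h : Finset.Iic i ⊆ Finset.univ.filter fun i' => (k i' : ℕ) < x := by
    intro i' hi'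
    have h2 : k i' ≤ k i := hk.monotone (Finset.mem_Iic.1 hi')
    have h3 : (k i' : ℕ) ≤ k i := h2
    simp only [Finset.mem_filter, Finset.mem_univ, true_and]
    omega
  have := Finset.card_le_card h
  rw [Fin.card_Iic] at this
  exact_mod_cast this

/-- In terms of the increasing enumerations of both sets, interlacing is the condition on two
consecutive rows of a monotone triangle. -/
theorem interlaces_image_iff {m N : ℕ} {l : Fin m → Fin N} {k : Fin (m + 1) → Fin N}
    (hl : StrictMono l) (hk : StrictMono k) :
    Interlaces (Finset.univ.image l) (Finset.univ.image k) ↔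
      ∀ i, k i.castSucc ≤ l i ∧ l i ≤ k i.succ := by
  have hsum : ∀ x, partialSum (fun j => columnIndicator (Finset.univ.image k) j -
      columnIndicator (Finset.univ.image l) j) x =
      (∑ i, if (k i : ℕ) < x then 1 else 0) - ∑ i, if (l i : ℕ) < x then 1 else 0 := by
    intro x
    rw [partialSum_sub, partialSum_columnIndicator_image hk.injective,
      partialSum_columnIndicator_image hl.injective]
  constructor
  · rintro ⟨h, -⟩ i
    constructor
    · by_contra! hlt
      have h1 := sum_lt_apply hk i.castSucc
      have h2 := le_sum_of_lt hl i (x := k i.castSucc) hlt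
      have h3 := h (k i.castSucc)
      rw [hsum, h1] at h3
      rw [Fin.val_castSucc] at h3
      omega
    · by_contra! hlt
      have h1 := sum_lt_apply hl i
      have h2 := le_sum_of_lt hk i.succ (x := l i) hlt
      have h3 := h (l i)
      rw [hsum, h1] at h3
      rw [Fin.val_succ] at h2
      push_cast at h2
      omega
  · intro h
    refine ⟨fun x => ?_, ?_⟩
    · rw [hsum]
      have h1 : ∑ i, (if (l i : ℕ) < x then 1 else 0 : ℤ) ≤
          ∑ i : Fin m, if (k i.castSucc : ℕ) < x then 1 else 0 := by
        refine Finset.sum_le_sum fun i _ => ?_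
        have h' : (k i.castSucc : ℕ) ≤ l i := (h i).1
        split_ifs <;> omega
      have h2 : ∑ i : Fin m, (if (k i.succ : ℕ) < x then 1 else 0 : ℤ) ≤
          ∑ i, if (l i : ℕ) < x then 1 else 0 := by
        refine Finset.sum_le_sum fun i _ => ?_
        have h' : (l i : ℕ) ≤ k i.succ := (h i).2
        split_ifs <;> omega
      have h3 := Fin.sum_univ_castSucc fun i => (if (k i : ℕ) < x then 1 else 0 : ℤ)
      have h4 := Fin.sum_univ_succ fun i => (if (k i : ℕ) < x then 1 else 0 : ℤ)
      have h5 : 0 ≤ (if (k (Fin.last m) : ℕ) < x then 1 else 0 : ℤ) := by split_ifs <;> omega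
      have h6 : (if (k 0 : ℕ) < x then 1 else 0 : ℤ) ≤ 1 := by split_ifs <;> omega
      omega
    · rw [Finset.sum_sub_distrib, sum_columnIndicator, sum_columnIndicator,
        Finset.card_image_of_injective _ hl.injective,
        Finset.card_image_of_injective _ hk.injective]
      simp

theorem card_columnIndicator_sub_eq_neg_one {N : ℕ} (T S : Finset (Fin N)) :
    (Finset.univ.filter fun j => columnIndicator S j - columnIndicator T j = -1).card =
      (T \ S).card := by
  congr 1
  ext j
  rw [Finset.mem_filter, Finset.mem_sdiff, columnIndicator, columnIndicator]
  split_ifs with h1 h2 h2 <;> simp [h1, h2]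

/-- For interlacing sequences, `l i` can only meet `k` in one of its two bounds `k i`, `k (i + 1)`,
so the weight of a row factors over the entries of `l`. -/
theorem two_pow_card_sdiff {m N : ℕ} {l : Fin m → Fin N} {k : Fin (m + 1) → Fin N}
    (hl : StrictMono l) (hk : StrictMono k) (h : ∀ i, k i.castSucc ≤ l i ∧ l i ≤ k i.succ) :
    (2 : ℤ) ^ (Finset.univ.image l \ Finset.univ.image k).card =
      ∏ i, if l i = k i.castSucc ∨ l i = k i.succ then 1 else 2 := by
  have h1 : Finset.univ.image l \ Finset.univ.image k =
      (Finset.univ.filter fun i => ¬(l i = k i.castSucc ∨ l i = k i.succ)).image l := by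
    ext j
    simp only [Finset.mem_sdiff, Finset.mem_image, Finset.mem_univ, true_and, Finset.mem_filter]
    constructor
    · rintro ⟨⟨i, rfl⟩, h2⟩
      exact ⟨i, fun h3 => h2 (h3.elim (fun h => ⟨_, h.symm⟩) fun h => ⟨_, h.symm⟩), rfl⟩
    · rintro ⟨i, h2, rfl⟩
      refine ⟨⟨i, rfl⟩, ?_⟩
      rintro ⟨p, hp⟩
      have h3 := h i
      rw [← hp, hk.le_iff_le, hk.le_iff_le, Fin.le_def, Fin.le_def, Fin.val_castSucc,
        Fin.val_succ] at h3
      have h4 : p = i.castSucc ∨ p = i.succ := by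
        rw [Fin.ext_iff, Fin.ext_iff, Fin.val_castSucc, Fin.val_succ]
        omega
      rcases h4 with rfl | rfl
      · exact h2 (Or.inl hp.symm)
      · exact h2 (Or.inr hp.symm)
  rw [h1, Finset.card_image_of_injective _ hl.injective, Finset.prod_ite]
  simp

/-! ### Building matrices row by row -/

open Classical in
/-- The `m × N` matrices that can be the first `m` rows of an alternating sign matrix and have
column sums `1_S`, built row by row: if the first `m` rows have column sums `1_T`, then the next
row is `1_S - 1_T`. -/
noncomputable def partialASM {N : ℕ} :
    (m : ℕ) → Finset (Fin N) → Finset (Fin m → Fin N → ℤ)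
  | 0, S => if S = ∅ then {fun i => i.elim0} else ∅
  | m + 1, S => (Finset.univ.filter (Interlaces · S)).biUnion fun T =>
      (partialASM m T).image fun B =>
        Fin.snoc (α := fun _ => Fin N → ℤ) B fun j => columnIndicator S j - columnIndicator T j

theorem columnIndicator_injective {N : ℕ} :
    Function.Injective (columnIndicator : Finset (Fin N) → Fin N → ℤ) := by
  intro S T h
  ext j
  have := congrFun h j
  unfold columnIndicator at this
  split_ifs at this <;> simp_all

/-- The row-by-row construction yields exactly the matrices all of whose rows are admissible, whose
column partial sums are `0` or `1`, and whose column sums are `1_S`. -/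
theorem mem_partialASM {N m : ℕ} {S : Finset (Fin N)} {A : Fin m → Fin N → ℤ} :
    A ∈ partialASM m S ↔ (∀ i, IsAlternatingSign (A i)) ∧
      (∀ j k, partialSum (fun i => A i j) k = 0 ∨ partialSum (fun i => A i j) k = 1) ∧
      ∀ j, ∑ i, A i j = columnIndicator S j := by
  induction m generalizing S with
  | zero =>
    have hA : A = fun i => i.elim0 := Subsingleton.elim _ _
    by_cases hS : S = ∅
    · simp [partialASM, hS, hA, partialSum, columnIndicator]
    · obtain ⟨j, hj⟩ := Finset.nonempty_iff_ne_empty.2 hS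
      simp only [partialASM, hS, if_false, Finset.notMem_empty, false_iff]
      rintro ⟨-, -, h⟩
      simpa [columnIndicator, hj] using h j
  | succ m ih =>
    simp only [partialASM, Finset.mem_biUnion, Finset.mem_filter, Finset.mem_univ, true_and,
      Finset.mem_image]
    constructor
    · rintro ⟨T, hT, B, hB, rfl⟩
      obtain ⟨h1, h2, h3⟩ := ih.1 hB
      have hs : ∀ j, ∑ i, (Fin.snoc (α := fun _ => Fin N → ℤ) B (fun j =>
          columnIndicator S j - columnIndicator T j) : Fin (m + 1) → Fin N → ℤ) i j =
          columnIndicator S j := by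
        intro j
        rw [Fin.sum_univ_castSucc]
        simp [h3]
      refine ⟨fun i => ?_, fun j k => ?_, hs⟩
      · induction i using Fin.lastCases with
        | last => rw [Fin.snoc_last]; exact hT
        | cast i => rw [Fin.snoc_castSucc]; exact h1 i
      · rcases Nat.lt_or_ge m k with hk | hk
        · rw [partialSum_of_le _ hk, hs, columnIndicator]
          split_ifs <;> simp
        · rw [partialSum_init _ hk]
          simp only [Fin.snoc_castSucc]
          exact h2 j k
    · rintro ⟨h1, h2, h3⟩
      let T : Finset (Fin N) := Finset.univ.filter fun j => ∑ i : Fin m, A i.castSucc j = 1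
      have hT : ∀ j, ∑ i : Fin m, A i.castSucc j = columnIndicator T j := by
        intro j
        have := h2 j m
        rw [partialSum_init _ le_rfl, partialSum_of_le _ le_rfl] at this
        simp only [columnIndicator, T, Finset.mem_filter, Finset.mem_univ, true_and]
        split_ifs <;> omega
      have hlast : A (Fin.last m) = fun j => columnIndicator S j - columnIndicator T j := by
        ext j
        have := h3 j
        rw [Fin.sum_univ_castSucc, hT] at this
        omega
      refine ⟨T, ?_, fun i => A i.castSucc, ih.2 ⟨fun i => h1 _, fun j k => ?_, hT⟩, ?_⟩
      · rw [Interlaces, ← hlast]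
        exact h1 _
      · rcases Nat.lt_or_ge m k with hk | hk
        · rw [partialSum_of_le _ hk.le, hT, columnIndicator]
          split_ifs <;> simp
        · rw [← partialSum_init (fun i => A i j) hk]
          exact h2 j k
      · rw [← hlast]
        exact Fin.snoc_init_self A

/-- The weight `2 ^ μ` of a rectangular matrix with `μ` entries `-1`, as a product over rows. -/
def twoWeight {m N : ℕ} (A : Fin m → Fin N → ℤ) : ℤ :=
  ∏ i, 2 ^ (Finset.univ.filter fun j => A i j = -1).card

open Classical in
theorem sum_partialASM_succ {N : ℕ} (m : ℕ) (S : Finset (Fin N)) :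
    ∑ A ∈ partialASM (m + 1) S, twoWeight A =
      ∑ T with Interlaces T S, 2 ^ (T \ S).card * ∑ B ∈ partialASM m T, twoWeight B := by
  rw [partialASM, Finset.sum_biUnion]
  · refine Finset.sum_congr rfl fun T _ => ?_
    rw [Finset.sum_image, Finset.mul_sum]
    · refine Finset.sum_congr rfl fun B _ => ?_
      rw [twoWeight, Fin.prod_univ_castSucc, mul_comm]
      simp only [Fin.snoc_castSucc, Fin.snoc_last, card_columnIndicator_sub_eq_neg_one]
      rfl
    · intro B _ B' _ h
      exact (Fin.snoc_injective2 h).1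
  · -- The last row `1_S - 1_T` determines `T`.
    intro T _ T' _ hne
    rw [Function.onFun, Finset.disjoint_left]
    intro A hA hA'
    obtain ⟨B, -, rfl⟩ := Finset.mem_image.1 hA
    obtain ⟨B', -, h⟩ := Finset.mem_image.1 hA'
    refine hne (columnIndicator_injective (funext fun j => ?_))
    have := congrFun (Fin.snoc_injective2 h).2 j
    omega

/-! ### The 2-enumeration -/

/-- The matrices with `m` rows and column sums `1_S`, where `S` is enumerated increasingly by
`k`, have total weight `2 ^ C(m, 2) * det (C(k i, j))`. -/
theorem sum_partialASM_image {N m : ℕ} {k : Fin m → Fin N} (hk : StrictMono k) :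
    ∑ A ∈ partialASM m (Finset.univ.image k), twoWeight A =
      2 ^ m.choose 2 * chooseDet fun i => (k i : ℕ) := by
  classical
  induction m with
  | zero => simp [partialASM, twoWeight, chooseDet]
  | succ m ih =>
    have hdet : ∑ l ∈ (Fintype.piFinset fun i : Fin m =>
          Finset.Icc (k i.castSucc) (k i.succ)).filter StrictMono,
        (∏ i, if l i = k i.castSucc ∨ l i = k i.succ then 1 else 2) *
          chooseDet (fun i => (l i : ℕ)) = 2 ^ m * chooseDet fun i => (k i : ℕ) := by
      rw [← sum_piFinset_chooseDet hk]
      refine Finset.sum_subset (Finset.filter_subset _ _) fun l hl hl' => ?_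
      -- The sum over the whole box may be used: a tuple in it is weakly increasing, so if
      -- it is not strictly increasing, two entries agree and its determinant vanishes.
      have hmono : Monotone l := by
        cases m with
        | zero => exact fun i => i.elim0
        | succ m =>
          refine Fin.monotone_iff_le_succ.2 fun i => ?_
          have h1 := (Finset.mem_Icc.1 (Fintype.mem_piFinset.1 hl i.castSucc)).2
          have h2 := (Finset.mem_Icc.1 (Fintype.mem_piFinset.1 hl i.succ)).1
          exact h1.trans h2
      rw [chooseDet_eq_zero, mul_zero]
      intro hinj
      refine hl' (Finset.mem_filter.2 ⟨hl, hmono.strictMono_of_injective fun i j h => hinj ?_⟩)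
      simp only [h]
    rw [sum_partialASM_succ, Nat.choose_succ_succ' m 1, Nat.choose_one_right,
      add_comm m (m.choose _), pow_add,
      mul_assoc, ← hdet, Finset.mul_sum]
    symm
    -- Interlacing sets correspond to the strictly increasing tuples in the box.
    refine Finset.sum_nbij (fun l => Finset.univ.image l) ?_ ?_ ?_ ?_
    · intro l hl
      rw [Finset.mem_filter, Fintype.mem_piFinset] at hl
      rw [Finset.mem_filter, interlaces_image_iff hl.2 hk]
      exact ⟨Finset.mem_univ _, fun i => Finset.mem_Icc.1 (hl.1 i)⟩
    · intro l hl l' hl' h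
      have h1 := (Finset.mem_filter.1 (Finset.mem_coe.1 hl)).2
      have h2 := (Finset.mem_filter.1 (Finset.mem_coe.1 hl')).2
      refine (StrictMono.range_inj h1 h2).1 ?_
      simpa using congrArg (fun s : Finset (Fin N) => (s : Set (Fin N))) h
    · intro T hT
      have hT := (Finset.mem_filter.1 (Finset.mem_coe.1 hT)).2
      have hcard : T.card = m := by
        have := hT.card_eq
        rw [Finset.card_image_of_injective _ hk.injective, Finset.card_univ,
          Fintype.card_fin] at this
        omega
      have himage : Finset.univ.image (T.orderEmbOfFin hcard) = T := by
        rw [← Finset.coe_inj]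
        simp
      have hmono : StrictMono (T.orderEmbOfFin hcard) := OrderEmbedding.strictMono _
      refine ⟨T.orderEmbOfFin hcard, ?_, himage⟩
      rw [← himage, interlaces_image_iff hmono hk] at hT
      rw [Finset.mem_coe, Finset.mem_filter, Fintype.mem_piFinset]
      exact ⟨fun i => Finset.mem_Icc.2 (hT i), hmono⟩
    · intro l hl
      rw [Finset.mem_filter, Fintype.mem_piFinset] at hl
      rw [ih hl.2, two_pow_card_sdiff hl.2 hk fun i => Finset.mem_Icc.1 (hl.1 i)]
      ring

theorem of_mem_asmFinset_iff {n : ℕ} (A : Fin n → Fin n → ℤ) :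
    Matrix.of A ∈ asmFinset n ↔ A ∈ partialASM n Finset.univ := by
  have hcol : ∀ j : Fin n, columnIndicator Finset.univ j = 1 := fun j => by
    simp [columnIndicator]
  simp only [asmFinset, Set.Finite.mem_toFinset, Set.mem_ofPred_eq, mem_partialASM, hcol]
  constructor
  · intro h
    exact ⟨fun i => (isAlternatingSign_iff _).2 ⟨h.entries i, h.row_sum i, h.row_alternate i⟩,
      fun j => ((isAlternatingSign_iff _).2
        ⟨fun i => h.entries i j, h.col_sum j, h.col_alternate j⟩).1, h.col_sum⟩
  · rintro ⟨h1, h2, h3⟩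
    have hrow := fun i => (isAlternatingSign_iff _).1 (h1 i)
    have hcol := fun j => (isAlternatingSign_iff _).1 ⟨h2 j, h3 j⟩
    exact ⟨fun i => (hrow i).1, fun i => (hrow i).2.1, h3, fun i => (hrow i).2.2,
      fun j => (hcol j).2.2⟩

theorem twoWeight_eq_pow_numNegOnes {n : ℕ} (A : Fin n → Fin n → ℤ) :
    twoWeight A = 2 ^ numNegOnes (Matrix.of A) := by
  rw [twoWeight, Finset.prod_pow_eq_pow_sum, numNegOnes, Finset.card_filter,
    Fintype.sum_prod_type]
  simp only [Finset.card_filter]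
  rfl

theorem mainTheorem9 (n : ℕ) : asmEnumeration n (2 : ℕ) = 2 ^ n.choose 2 := by
  have h := sum_partialASM_image (strictMono_id : StrictMono (id : Fin n → Fin n))
  rw [Finset.image_id] at h
  simp only [id, chooseDet_val, mul_one] at h
  have hsum : ∑ A ∈ partialASM n Finset.univ, twoWeight A =
      ∑ A ∈ asmFinset n, (2 : ℤ) ^ numNegOnes A :=
    Finset.sum_equiv Matrix.of (fun A => (of_mem_asmFinset_iff A).symm)
      fun A _ => twoWeight_eq_pow_numNegOnes A
  rw [hsum] at h
  rw [asmEnumeration]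
  exact_mod_cast h
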